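/- **Language.** Let $\mathrm{Prop}$ be a set of propositional variables. The language $\mathcal L$ is the least language with $$\phi ::= p \mid \bot \mid \neg\phi \mid \phi\lor\psi \mid \phi\preceq\psi \mid \phi\preceq^\Gamma\psi \mid \phi\unlhd^\Gamma\psi \mid \phi\sqsubseteq^\Gamma\psi ,$$ where $\Gamma$ ranges over the finite sets of (previously formed) $\mathcal L$-formulas. Put $\top:=\neg\bot$, $\phi\land\psi:=\neg(\neg\phi\lor\neg\psi)$, $\phi\to\psi:=\neg\phi\lor\psi$, $\phi\leftrightarrow\psi:=(\phi\to\psi)\land(\psi\to\phi)$ and $\Diamond\phi:=\neg(\bot\preceq\phi)$. **Semantics.** A *conditional frame* $F$ is a non-empty set $W$ with, for every $w\in W$, a set $W_w\subseteq W$ containing $w$ and a reflexive, transitive, total relation $\preceq_w$ on $W_w$ such that $w\prec_w v$ for all $v\in W_w\setminus\{w\}$. It satisfies the *limit assumption* if for every $w$ every non-empty subset of $W_w$ has a $\preceq_w$-minimal element. Given a valuation $V:\mathrm{Prop}\to 2^W$, let $A_\Gamma(u,v)$ be the set of $\gamma\in\Gamma$ on which $u$ and $v$ agree, let $[w]_\Gamma=\{u\in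 W_w: A_\Gamma(u,w)=\Gamma\}$, and define - $u\unlhd^\Gamma_w v$ iff $u\preceq_w v$ and $u,v\in[w]_\Gamma$; - for $u,v\in W_w$: $u\preceq^\Gamma_w v$ iff $|A_\Gamma(u,w)|>|A_\Gamma(v,w)|$, or $|A_\Gamma(u,w)|=|A_\Gamma(v,w)|$ and $u\preceq_w v$; - for $u,v\in W_w$: $u\sqsubseteq^\Gamma_w v$ iff $A_\Gamma(v,w)\subsetneq A_\Gamma(u,w)$, or $A_\Gamma(v,w)=A_\Gamma(u,w)$ and $u\preceq_w v$. Variables and Boolean connectives are interpreted as usual; $\phi\preceq\psi$ is true at $w$ iff for every $u\in W_w$ there is $v\in W_w$ such that if $u$ satisfies $\psi$, then $v$ satisfies $\phi$ and $v\preceq_w u$. The clauses for $\preceq^\Gamma$ and $\sqsubseteq^\Gamma$ are the same with $\preceq^\Gamma_w$ and $\sqsubseteq^\Gamma_w$ in place of $\preceq_w$, and the clause for $\unlhd^\Gamma$ is the same with $[w]_\Gamma$ and $\unlhd^\Gamma_w$ in place of $W_w$ and $\preceq_w$. A formula is *valid* on a class of frames if it is true at every world under every valuation on every frame of the class. **Axiom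 system.** All schemata range over all $\mathcal L$-formulas and all finite sets $\Gamma$ of $\mathcal L$-formulas. The first part is Lewis's VC: - all truth-functional tautologies, and modus ponens; - for every $n\ge 1$: from $\phi\to(\psi_1\lor\dots\lor\psi_n)$ infer $(\psi_1\preceq\phi)\lor\dots\lor(\psi_n\preceq\phi)$; - $((\phi\preceq\psi)\land(\psi\preceq\chi))\to(\phi\preceq\chi)$ and $(\phi\preceq\psi)\lor(\psi\preceq\phi)$; - $\phi\to(\phi\preceq\top)$ and $(\phi\preceq\top)\to\phi$. The second part consists of the reduction equivalences. For $S,T\subseteq\Gamma$ let $\lambda^S_T$ be the conjunction of all $\gamma\in T\cap S$ and all $\neg\gamma$ with $\gamma\in T\setminus S$ (so $\lambda^S_\emptyset$ is $\top$). - $\displaystyle \phi\unlhd^\Gamma\psi\;\leftrightarrow\;\bigwedge_{S\subseteq\Gamma}\Big[\lambda^S_\Gamma\to(\phi\land\lambda^S_\Gamma)\preceq(\psi\land\lambda^S_\Gamma)\Big]$ - $\displaystyle \phi\sqsubseteq^\Gamma\psi\;\leftrightarrow\;\bigwedge_{S\subseteq\Gamma}\Big(\lambda^S_\Gamma\to\bigwedge_{T\subseteq\Gamma}\Big[\bigwedge_{T\subsetneq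 T'\subseteq\Gamma}\neg\Diamond(\phi\land\lambda^S_{T'})\to(\phi\land\lambda^S_T)\preceq(\psi\land\lambda^S_T)\Big]\Big)$ - $\displaystyle \phi\preceq^\Gamma\psi\;\leftrightarrow\;\bigwedge_{S\subseteq\Gamma}\Big(\lambda^S_\Gamma\to\bigwedge_{T\subseteq\Gamma}\Big[\bigwedge_{T'\subseteq\Gamma,\ |T'|>|T|}\neg\Diamond(\phi\land\lambda^S_{T'})\to\Big(\phi\land\bigvee_{T'\subseteq\Gamma,\ |T'|=|T|}\lambda^S_{T'}\Big)\preceq(\psi\land\lambda^S_T)\Big]\Big)$ **Theorem.** The logic of conditional frames in the language $\mathcal L$ is completely axiomatised by this system: for every $\mathcal L$-formula $\phi$, $\phi$ is derivable if and only if $\phi$ is valid on the class of conditional frames satisfying the limit assumption, and also if and only if $\phi$ is valid on the class of all conditional frames. -/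

import Mathlib

universe u v

namespace CeterisParibus

/-! ### The language

Formulas of `𝓛` carry finite *sets* of formulas. They are realised as those formulas with finite
lists in which every list is the chosen enumeration `Finset.toList` of the set of its entries, so
that a finite set of formulas has exactly one representative. The constructors `Formula.var`, …,
`Formula.cmp`, the induction principle and the recursor below show that the outcome is the type
freely generated by the grammar, with genuine finite sets `Γ`. -/

/-- The three kinds of superscripted operators:
`nc` for `⪯^Γ`, `cp` for `⊴^Γ`, `ms` for `⊑^Γ`. -/
inductive Mode where
  | nc
  | cp
  | ms

/-- Formulas with finite lists in place of finite sets. -/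
inductive PreFormula (P : Type u) : Type u where
  | var (p : P) : PreFormula P
  | bot : PreFormula P
  | neg (φ : PreFormula P) : PreFormula P
  | or (φ ψ : PreFormula P) : PreFormula P
  | le (φ ψ : PreFormula P) : PreFormula P
  | cmp (m : Mode) (Γ : List (PreFormula P)) (φ ψ : PreFormula P) : PreFormula P

open Classical in
/-- Every list in the formula is the chosen enumeration of a finite set. -/
inductive PreFormula.WF {P : Type u} : PreFormula P → Prop where
  | var (p : P) : WF (.var p)
  | bot : WF .bot
  | neg {φ : PreFormula P} : WF φ → WF (.neg φ)
  | or {φ ψ : PreFormula P} : WF φ → WF ψ → WF (.or φ ψ)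
  | le {φ ψ : PreFormula P} : WF φ → WF ψ → WF (.le φ ψ)
  | cmp (m : Mode) {Γ : List (PreFormula P)} {φ ψ : PreFormula P} :
      (∀ γ ∈ Γ, WF γ) → Γ.toFinset.toList = Γ → WF φ → WF ψ → WF (.cmp m Γ φ ψ)

/-- The language `𝓛` over the propositional variables `P`. -/
@[ext]
structure Formula (P : Type u) : Type u where
  /-- The formula with finite lists. -/
  val : PreFormula P
  wf : val.WF

namespace Formula

variable {P : Type u}

/-- The injection of formulas into formulas with finite lists. -/
def toPre : Formula P ↪ PreFormula P := ⟨val, fun _ _ h => Formula.ext h⟩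

/-- A propositional variable. -/
def var (p : P) : Formula P := ⟨.var p, .var p⟩

/-- Falsum. -/
def bot : Formula P := ⟨.bot, .bot⟩

/-- Negation. -/
def neg (φ : Formula P) : Formula P := ⟨.neg φ.1, .neg φ.2⟩

/-- Disjunction. -/
def or (φ ψ : Formula P) : Formula P := ⟨.or φ.1 ψ.1, .or φ.2 ψ.2⟩

/-- Comparative possibility `φ ⪯ ψ`. -/
def le (φ ψ : Formula P) : Formula P := ⟨.le φ.1 ψ.1, .le φ.2 ψ.2⟩

/-- `φ ⪯^Γ ψ`, `φ ⊴^Γ ψ` and `φ ⊑^Γ ψ`, according to `m`. -/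
noncomputable def cmp (m : Mode) (Γ : Finset (Formula P)) (φ ψ : Formula P) : Formula P :=
  ⟨.cmp m (Γ.map toPre).toList φ.1 ψ.1, by
    classical
    refine .cmp m ?_ ?_ φ.2 ψ.2
    · intro γ hγ
      obtain ⟨δ, -, rfl⟩ := Finset.mem_map.1 (Finset.mem_toList.1 hγ)
      exact δ.wf
    · rw [Finset.toList_toFinset]⟩

open Classical in
/-- The finite set of formulas enumerated by a list. -/
noncomputable def ofList (Γ : List (PreFormula P)) (h : ∀ γ ∈ Γ, γ.WF) : Finset (Formula P) :=
  (Γ.attach.map fun γ => (⟨γ.1, h γ.1 γ.2⟩ : Formula P)).toFinset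

theorem mem_ofList {Γ : List (PreFormula P)} (h : ∀ γ ∈ Γ, γ.WF) {γ : Formula P} :
    γ ∈ ofList Γ h ↔ γ.1 ∈ Γ := by
  classical
  simp only [ofList, List.mem_toFinset, List.mem_map, List.mem_attach, true_and, Subtype.exists]
  constructor
  · rintro ⟨δ, hδ, rfl⟩
    exact hδ
  · intro hγ
    exact ⟨γ.1, hγ, rfl⟩

theorem ofList_toList (Γ : Finset (Formula P))
    (h : ∀ γ ∈ (Γ.map toPre).toList, γ.WF) :
    ofList _ h = Γ := by
  ext γ
  rw [mem_ofList h, Finset.mem_toList]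
  exact Finset.mem_map' toPre

theorem cmp_ofList (m : Mode) {Γ : List (PreFormula P)} {φ ψ : PreFormula P}
    (h : (PreFormula.cmp m Γ φ ψ).WF) (hΓ : ∀ γ ∈ Γ, γ.WF) (hφ : φ.WF) (hψ : ψ.WF) :
    (⟨.cmp m Γ φ ψ, h⟩ : Formula P) = cmp m (ofList Γ hΓ) ⟨φ, hφ⟩ ⟨ψ, hψ⟩ := by
  classical
  have e : (ofList Γ hΓ).map toPre = Γ.toFinset := by
    ext γ
    rw [Finset.mem_map, List.mem_toFinset]
    constructor
    · rintro ⟨δ, hδ, rfl⟩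
      exact (mem_ofList hΓ).1 hδ
    · intro hγ
      exact ⟨⟨γ, hΓ γ hγ⟩, (mem_ofList hΓ).2 hγ, rfl⟩
  cases h with
  | cmp _ _ hl _ _ =>
    refine Formula.ext ?_
    change PreFormula.cmp m Γ φ ψ = PreFormula.cmp m (Finset.toList _) φ ψ
    rw [e]
    conv_lhs => rw [← hl]

/-- Induction on formulas. -/
theorem induction {motive : Formula P → Prop}
    (var : ∀ p, motive (var p)) (bot : motive bot)
    (neg : ∀ φ, motive φ → motive (neg φ))
    (or : ∀ φ ψ, motive φ → motive ψ → motive (or φ ψ))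
    (le : ∀ φ ψ, motive φ → motive ψ → motive (le φ ψ))
    (cmp : ∀ m Γ φ ψ, (∀ γ ∈ Γ, motive γ) → motive φ → motive ψ → motive (cmp m Γ φ ψ))
    (φ : Formula P) : motive φ := by
  obtain ⟨φ, h⟩ := φ
  have key : ∀ (φ : PreFormula P), φ.WF → ∀ h : φ.WF, motive ⟨φ, h⟩ := by
    intro φ h
    induction h with
    | var p => exact fun _ => var p
    | bot => exact fun _ => bot
    | neg h ih => exact fun _ => neg _ (ih h)
    | or h₁ h₂ ih₁ ih₂ => exact fun _ => or _ _ (ih₁ h₁) (ih₂ h₂)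
    | le h₁ h₂ ih₁ ih₂ => exact fun _ => le _ _ (ih₁ h₁) (ih₂ h₂)
    | cmp m hΓ hl h₁ h₂ ihΓ ih₁ ih₂ =>
      intro h
      rw [cmp_ofList m h hΓ h₁ h₂]
      exact cmp m _ _ _ (fun γ hγ => ihΓ γ.1 ((mem_ofList hΓ).1 hγ) γ.wf) (ih₁ h₁) (ih₂ h₂)
  exact key φ h h

section Recursor

variable {C : Type v} (fvar : P → C) (fbot : C) (fneg : C → C) (for' : C → C → C)
  (fle : C → C → C) (fcmp : Mode → (Γ : Finset (Formula P)) → (Γ → C) → C → C → C)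

/-- Auxiliary recursion for `Formula.recursor`. -/
noncomputable def recAux : (φ : PreFormula P) → φ.WF → C
  | .var p, _ => fvar p
  | .bot, _ => fbot
  | .neg φ, h => fneg (recAux φ (by cases h; assumption))
  | .or φ ψ, h => for' (recAux φ (by cases h; assumption)) (recAux ψ (by cases h; assumption))
  | .le φ ψ, h => fle (recAux φ (by cases h; assumption)) (recAux ψ (by cases h; assumption))
  | .cmp m Γ φ ψ, h =>
      fcmp m (ofList Γ (by cases h; assumption)) (fun γ => recAux γ.1.1 γ.1.2)
        (recAux φ (by cases h; assumption)) (recAux ψ (by cases h; assumption))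
termination_by φ => sizeOf φ
decreasing_by
  all_goals simp_wf
  all_goals try omega
  have := List.sizeOf_lt_of_mem ((mem_ofList _).1 γ.2)
  omega

/-- Recursion on formulas: the value at `cmp m Γ φ ψ` is given in terms of the values at `φ`, at
`ψ` and at the members of `Γ`. -/
noncomputable def recursor (φ : Formula P) : C := recAux fvar fbot fneg for' fle fcmp φ.1 φ.2

theorem recursor_var (p : P) : recursor fvar fbot fneg for' fle fcmp (var p) = fvar p := by
  simp only [recursor, var, recAux]

theorem recursor_bot : recursor fvar fbot fneg for' fle fcmp bot = fbot := by
  simp only [recursor, bot, recAux]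

theorem recursor_neg (φ : Formula P) : recursor fvar fbot fneg for' fle fcmp (neg φ) =
    fneg (recursor fvar fbot fneg for' fle fcmp φ) := by
  simp only [recursor, neg, recAux]

theorem recursor_or (φ ψ : Formula P) : recursor fvar fbot fneg for' fle fcmp (or φ ψ) =
    for' (recursor fvar fbot fneg for' fle fcmp φ) (recursor fvar fbot fneg for' fle fcmp ψ) := by
  simp only [recursor, or, recAux]

theorem recursor_le (φ ψ : Formula P) : recursor fvar fbot fneg for' fle fcmp (le φ ψ) =
    fle (recursor fvar fbot fneg for' fle fcmp φ) (recursor fvar fbot fneg for' fle fcmp ψ) := by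
  simp only [recursor, le, recAux]

theorem recursor_cmp (m : Mode) (Γ : Finset (Formula P)) (φ ψ : Formula P) :
    recursor fvar fbot fneg for' fle fcmp (cmp m Γ φ ψ) =
      fcmp m Γ (fun γ => recursor fvar fbot fneg for' fle fcmp γ.1)
        (recursor fvar fbot fneg for' fle fcmp φ) (recursor fvar fbot fneg for' fle fcmp ψ) := by
  have key : ∀ (Γ' : Finset (Formula P)) (a b : C), Γ' = Γ →
      fcmp m Γ' (fun γ => recursor fvar fbot fneg for' fle fcmp γ.1) a b =
      fcmp m Γ (fun γ => recursor fvar fbot fneg for' fle fcmp γ.1) a b := by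
    rintro Γ' a b rfl
    rfl
  rw [← key _ _ _ (ofList_toList Γ (by
    intro γ hγ
    obtain ⟨δ, -, rfl⟩ := Finset.mem_map.1 (Finset.mem_toList.1 hγ)
    exact δ.2))]
  simp only [recursor, cmp]
  rw [recAux]

end Recursor

/-! ### Abbreviations -/

/-- Verum. -/
def top : Formula P := neg bot

/-- Conjunction. -/
def and (φ ψ : Formula P) : Formula P := neg (or (neg φ) (neg ψ))

/-- Implication. -/
def imp (φ ψ : Formula P) : Formula P := or (neg φ) ψ

/-- Equivalence. -/
def iff (φ ψ : Formula P) : Formula P := and (imp φ ψ) (imp ψ φ)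

/-- `φ ≺ ψ := ¬(ψ ⪯ φ)`. -/
def lt (φ ψ : Formula P) : Formula P := neg (le ψ φ)

/-- `◇φ := φ ≺ ⊥`. -/
def dia (φ : Formula P) : Formula P := lt φ bot

/-- Disjunction of a list; `⊥` if the list is empty. -/
def disj (l : List (Formula P)) : Formula P := l.foldr or bot

/-- Conjunction of a list; `⊤` if the list is empty. -/
def conj (l : List (Formula P)) : Formula P := l.foldr and top

/-- `⋁ i ∈ s, f i`. -/
noncomputable def bigOr {ι : Type v} (s : Finset ι) (f : ι → Formula P) : Formula P :=
  disj (s.toList.map f)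

/-- `⋀ i ∈ s, f i`. -/
noncomputable def bigAnd {ι : Type v} (s : Finset ι) (f : ι → Formula P) : Formula P :=
  conj (s.toList.map f)

/-! ### The reduction equivalences

A member of `Γ^*`, i.e. a conjunction `⋀ γ ∈ Γ, ± γ`, is given by the set `S ⊆ Γ` of the formulas
that are taken with a positive sign; the subconjunctions of this member are given by the sets
`T ⊆ Γ` of the formulas that occur in them. -/

open Classical in
/-- The conjunction of the literals `± γ` for `γ ∈ T`, where `γ` is positive iff `γ ∈ S`. -/
noncomputable def lits (S T : Finset (Formula P)) : Formula P :=
  bigAnd T fun γ => if γ ∈ S then γ else neg γ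

/-- The right-hand side of the reduction equivalence for `φ ⊴^Γ ψ`. -/
noncomputable def reductCP (Γ : Finset (Formula P)) (φ ψ : Formula P) : Formula P :=
  bigAnd Γ.powerset fun S =>
    imp (lits S Γ) (le (and φ (lits S Γ)) (and ψ (lits S Γ)))

open Classical in
/-- The right-hand side of the reduction equivalence for `φ ⊑^Γ ψ`. -/
noncomputable def reductMS (Γ : Finset (Formula P)) (φ ψ : Formula P) : Formula P :=
  bigAnd Γ.powerset fun S =>
    imp (lits S Γ) <|
      bigAnd Γ.powerset fun T =>
        imp (bigAnd (Γ.powerset.filter fun T' => T ⊂ T') fun T' => neg (dia (and φ (lits S T'))))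
          (le (and φ (lits S T)) (and ψ (lits S T)))

open Classical in
/-- The right-hand side of the reduction equivalence for `φ ⪯^Γ ψ`. -/
noncomputable def reductNC (Γ : Finset (Formula P)) (φ ψ : Formula P) : Formula P :=
  bigAnd Γ.powerset fun S =>
    imp (lits S Γ) <|
      bigAnd Γ.powerset fun T =>
        imp (bigAnd (Γ.powerset.filter fun T' => T.card < T'.card)
              fun T' => neg (dia (and φ (lits S T'))))
          (le (and φ (bigOr (Γ.powerset.filter fun T' => T'.card = T.card) fun T' => lits S T'))
            (and ψ (lits S T)))

/-- The right-hand sides of the three families of reduction equivalences. -/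
noncomputable def reduct : Mode → Finset (Formula P) → Formula P → Formula P → Formula P
  | .nc => reductNC
  | .cp => reductCP
  | .ms => reductMS

/-- Truth-functional tautologies: true under every assignment of truth values to formulas that
respects `⊥`, `¬` and `∨`. -/
def IsTautology (φ : Formula P) : Prop :=
  ∀ t : Formula P → Prop, ¬ t bot → (∀ χ, t (neg χ) ↔ ¬ t χ) →
    (∀ χ θ, t (or χ θ) ↔ t χ ∨ t θ) → t φ

end Formula

open Formula in
/-- Theoremhood in Lewis's system VC for comparative possibility (on the whole language `𝓛`)
together with the reduction equivalences. -/
inductive Provable {P : Type u} : Formula P → Prop where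
  /-- Truth-functional tautologies. -/
  | taut {φ : Formula P} : IsTautology φ → Provable φ
  /-- Modus ponens. -/
  | mp {φ ψ : Formula P} : Provable (imp φ ψ) → Provable φ → Provable ψ
  /-- The rule for comparative possibility, for every `n ≥ 1`:
  from `φ → ψ₁ ∨ … ∨ ψₙ` infer `(ψ₁ ⪯ φ) ∨ … ∨ (ψₙ ⪯ φ)`. -/
  | cpr {φ : Formula P} {l : List (Formula P)} : l ≠ [] → Provable (imp φ (disj l)) →
      Provable (disj (l.map fun ψ => le ψ φ))
  /-- Transitivity. -/
  | trans (φ ψ χ : Formula P) : Provable (imp (and (le φ ψ) (le ψ χ)) (le φ χ))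
  /-- Connexity. -/
  | connex (φ ψ : Formula P) : Provable (or (le φ ψ) (le ψ φ))
  /-- Weak centering. -/
  | weakCentering (φ : Formula P) : Provable (imp φ (le φ top))
  /-- Centering. -/
  | centering (φ : Formula P) : Provable (imp (le φ top) φ)
  /-- The reduction equivalences for `⪯^Γ`, `⊴^Γ` and `⊑^Γ`. -/
  | reduction (m : Mode) (Γ : Finset (Formula P)) (φ ψ : Formula P) :
      Provable (iff (cmp m Γ φ ψ) (reduct m Γ φ ψ))

/-! ### Semantics -/

/-- Conditional frames. Here `dom w` is the set `W_w` of worlds entertainable from `w`, and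
`sim w x y` says `x ⪯_w y`. -/
structure ConditionalFrame where
  /-- The set `W` of worlds. -/
  World : Type v
  nonempty : Nonempty World
  /-- The worlds entertainable from a world. -/
  dom : World → Set World
  /-- The similarity orders. -/
  sim : World → World → World → Prop
  mem_dom_of_sim : ∀ w x y, sim w x y → x ∈ dom w ∧ y ∈ dom w
  self_mem_dom : ∀ w, w ∈ dom w
  sim_refl : ∀ w, ∀ x ∈ dom w, sim w x x
  sim_trans : ∀ w x y z, sim w x y → sim w y z → sim w x z
  sim_total : ∀ w, ∀ x ∈ dom w, ∀ y ∈ dom w, sim w x y ∨ sim w y x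
  centered : ∀ w, ∀ x ∈ dom w, x ≠ w → sim w w x ∧ ¬ sim w x w

namespace ConditionalFrame

/-- The limit assumption: all similarity orders are well-founded, i.e. every set that contains an
entertainable world contains a minimal one. -/
def LimitAssumption (F : ConditionalFrame.{v}) : Prop :=
  ∀ (w : F.World) (S : Set F.World), (S ∩ F.dom w).Nonempty →
    ∃ x ∈ S ∩ F.dom w, ∀ y ∈ S ∩ F.dom w, ¬ (F.sim w y x ∧ ¬ F.sim w x y)

section Orders

variable (F : ConditionalFrame.{v}) {ι : Type u} [Fintype ι] (t : ι → Set F.World)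

open Classical in
/-- `A_Γ(x, y)`: the indices `i` such that `x` and `y` agree about the proposition `t i`. -/
noncomputable def agree (x y : F.World) : Finset ι :=
  Finset.univ.filter fun i => (x ∈ t i ↔ y ∈ t i)

/-- `[w]_Γ`: the worlds entertainable from `w` that agree with `w` about all the propositions
`t i`. -/
def cell (w : F.World) : Set F.World := {x ∈ F.dom w | ∀ i, w ∈ t i ↔ x ∈ t i}

/-- The domain on which the transformed order lives. -/
def modeDom : Mode → F.World → Set F.World
  | .nc, w => F.dom w
  | .cp, w => F.cell t w
  | .ms, w => F.dom w

/-- The orders `⪯^Γ_w`, `⊴^Γ_w` and `⊑^Γ_w` (on the domain `modeDom`). -/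
def modeSim : Mode → F.World → F.World → F.World → Prop
  | .nc, w, x, y => (F.agree t y w).card < (F.agree t x w).card ∨
      ((F.agree t x w).card = (F.agree t y w).card ∧ F.sim w x y)
  | .cp, w, x, y => F.sim w x y ∧ x ∈ F.cell t w ∧ y ∈ F.cell t w
  | .ms, w, x, y => F.agree t y w ⊂ F.agree t x w ∨
      (F.agree t y w = F.agree t x w ∧ F.sim w x y)

end Orders

/-- The worlds `w` such that for every `x ∈ D w` there is `y ∈ D w` such that if `x ∈ Y` then
`y ∈ X` and `y` is below `x` in the order `R w`. -/
def comparePoss {W : Type v} (D : W → Set W) (R : W → W → W → Prop) (X Y : Set W) : Set W :=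
  {w | ∀ x ∈ D w, ∃ y ∈ D w, x ∈ Y → y ∈ X ∧ R w y x}

/-- The truth set of a formula in the model given by the frame `F` and the valuation `V`. -/
noncomputable def truthSet {P : Type u} (F : ConditionalFrame.{v}) (V : P → Set F.World) :
    Formula P → Set F.World :=
  Formula.recursor V ∅ (fun X => Xᶜ) (fun X Y => X ∪ Y)
    (fun X Y => comparePoss F.dom F.sim X Y)
    (fun m _ t X Y => comparePoss (F.modeDom t m) (F.modeSim t m) X Y)

section Clauses

variable {P : Type u} (F : ConditionalFrame.{v}) (V : P → Set F.World)

theorem truthSet_var (p : P) : F.truthSet V (.var p) = V p :=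
  Formula.recursor_var ..

theorem truthSet_bot : F.truthSet V .bot = ∅ :=
  Formula.recursor_bot ..

theorem truthSet_neg (φ : Formula P) : F.truthSet V (.neg φ) = (F.truthSet V φ)ᶜ :=
  Formula.recursor_neg ..

theorem truthSet_or (φ ψ : Formula P) :
    F.truthSet V (.or φ ψ) = F.truthSet V φ ∪ F.truthSet V ψ :=
  Formula.recursor_or ..

theorem truthSet_le (φ ψ : Formula P) :
    F.truthSet V (.le φ ψ) = comparePoss F.dom F.sim (F.truthSet V φ) (F.truthSet V ψ) :=
  Formula.recursor_le ..

theorem truthSet_cmp (m : Mode) (Γ : Finset (Formula P)) (φ ψ : Formula P) :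
    F.truthSet V (.cmp m Γ φ ψ) =
      comparePoss (F.modeDom (fun γ : Γ => F.truthSet V γ.1) m)
        (F.modeSim (fun γ : Γ => F.truthSet V γ.1) m) (F.truthSet V φ) (F.truthSet V ψ) :=
  Formula.recursor_cmp ..

end Clauses

end ConditionalFrame

/-- The logic `Λ` of a class of conditional frames: the formulas that are true at every world of
every model based on a frame in the class. -/
def logicOf (P : Type u) (C : Set ConditionalFrame.{v}) : Set (Formula P) :=
  {φ | ∀ F ∈ C, ∀ (V : P → Set F.World) (w : F.World), w ∈ F.truthSet V φ}

end CeterisParibus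

/-!
Soundness over all conditional frames is checked axiom by axiom; the reduction equivalences rest on
the fact that, among the sets `S ⊆ Γ`, exactly one describes the evaluation world `w`, and that for
this `S` a world `x` satisfies `λ^S_T` iff `T ⊆ A_Γ(x, w)` (`truthSet_cmp_eq_truthSet_reduct`).

Completeness is proved by finite countermodels, which satisfy the limit assumption for free, so that
one construction serves both classes of frames. A *theory* is a Boolean valuation of formulas under
which every theorem is true; by compactness a formula is a theorem iff it belongs to every theory
(`provable_iff_forall_isTheory`). Given a finite set `D` of formulas, the worlds of the countermodel
are the theories modulo agreement on `D`, with one chosen representative `τ w` for each class. The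
class of `w` is described by a single formula `α w`, a conjunction of literals over `D`, and the
frame is read off from these formulas: `u` is entertainable from `w` iff `◇ α u ∈ τ w`, and
for such worlds `u ⪯_w v` iff `α u ⪯ α v ∈ τ w`. The axioms of VC make this a conditional frame; strict
centering holds because `α v ⪯ α w` and `α w` together give `α v ⪯ ⊤`, hence `α v`.

If `D` contains `φ` and `ψ`, then `φ` is provably equivalent to the disjunction of the `α u` with
`φ ∈ τ u`, and likewise for `ψ`. The rule for comparative possibility then yields the truth lemma
for `φ ⪯ ψ` (`Canonical.le_mem_iff`). The superscripted operators need no translation into the base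
language: soundness of the reduction equivalences on the countermodel, together with their presence
in every theory, reduces the truth lemma for `cmp m Γ φ ψ` to that for formulas built from `Γ`, `φ`
and `ψ` by Boolean connectives and `⪯`. The truth lemma is therefore proved in the form “for all
large enough finite `D`” (`TruthLemma`), which is closed under all these operations.
-/

namespace CeterisParibus

open Formula

universe u' v'

variable {P : Type u}

/-! ### Boolean valuations -/

/-- An assignment of truth values to formulas that respects `⊥`, `¬` and `∨`. -/
structure IsBoolean (t : Formula P → Prop) : Prop where
  bot : ¬ t bot
  neg : ∀ χ, t (neg χ) ↔ ¬ t χ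
  or : ∀ χ θ, t (or χ θ) ↔ t χ ∨ t θ

namespace IsBoolean

variable {t : Formula P → Prop}

theorem top (ht : IsBoolean t) : t top := (ht.neg _).2 ht.bot

theorem and (ht : IsBoolean t) (φ ψ : Formula P) : t (and φ ψ) ↔ t φ ∧ t ψ := by
  rw [Formula.and, ht.neg, ht.or, ht.neg, ht.neg]
  tauto

theorem imp (ht : IsBoolean t) (φ ψ : Formula P) : t (imp φ ψ) ↔ (t φ → t ψ) := by
  rw [Formula.imp, ht.or, ht.neg]
  tauto

theorem iff (ht : IsBoolean t) (φ ψ : Formula P) : t (iff φ ψ) ↔ (t φ ↔ t ψ) := by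
  rw [Formula.iff, ht.and, ht.imp, ht.imp]
  tauto

theorem disj (ht : IsBoolean t) (l : List (Formula P)) : t (disj l) ↔ ∃ χ ∈ l, t χ := by
  induction l with
  | nil => simpa [Formula.disj] using ht.bot
  | cons χ l ih =>
    change t (Formula.or χ (Formula.disj l)) ↔ _
    rw [ht.or, ih]
    simp

theorem conj (ht : IsBoolean t) (l : List (Formula P)) : t (conj l) ↔ ∀ χ ∈ l, t χ := by
  induction l with
  | nil => simpa [Formula.conj] using ht.top
  | cons χ l ih =>
    change t (Formula.and χ (Formula.conj l)) ↔ _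
    rw [ht.and, ih]
    simp

theorem bigOr (ht : IsBoolean t) {ι : Type u'} (s : Finset ι) (f : ι → Formula P) :
    t (bigOr s f) ↔ ∃ i ∈ s, t (f i) := by
  rw [Formula.bigOr, ht.disj]
  simp

theorem bigAnd (ht : IsBoolean t) {ι : Type u'} (s : Finset ι) (f : ι → Formula P) :
    t (bigAnd s f) ↔ ∀ i ∈ s, t (f i) := by
  rw [Formula.bigAnd, ht.conj]
  simp

theorem lits (ht : IsBoolean t) (S T : Finset (Formula P)) :
    t (lits S T) ↔ ∀ γ ∈ T, (γ ∈ S ↔ t γ) := by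
  rw [Formula.lits, ht.bigAnd]
  refine forall₂_congr fun γ _ => ?_
  by_cases h : γ ∈ S
  · simp [h]
  · simp [h, ht.neg]

open Classical in
/-- Exactly one subset `S` of `Γ` gives a conjunction of literals that is true under `t`. -/
theorem forall_lits (ht : IsBoolean t) (Γ : Finset (Formula P)) (p : Finset (Formula P) → Prop) :
    (∀ S ∈ Γ.powerset, t (Formula.lits S Γ) → p S) ↔ p (Γ.filter t) := by
  constructor
  · intro h
    refine h _ (Finset.mem_powerset.2 (Finset.filter_subset _ _)) ((ht.lits _ _).2 ?_)
    intro γ hγ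
    simp [hγ]
  · intro h S hS hl
    have : S = Γ.filter t := by
      ext γ
      rw [Finset.mem_filter]
      rw [Finset.mem_powerset] at hS
      rw [ht.lits] at hl
      exact ⟨fun hγ => ⟨hS hγ, (hl γ (hS hγ)).1 hγ⟩, fun hγ => (hl γ hγ.1).2 hγ.2⟩
    rwa [this]

end IsBoolean

/-! ### Truth in a model and soundness -/

namespace ConditionalFrame

variable (F : ConditionalFrame.{v}) (V : P → Set F.World)

theorem isBoolean_truthSet (w : F.World) : IsBoolean fun φ => w ∈ F.truthSet V φ where
  bot := by simp [truthSet_bot]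
  neg χ := by simp [truthSet_neg]
  or χ θ := by simp [truthSet_or]

/-- If the domain at `w` is non-empty, the existential quantifier in `comparePoss` may be restricted
to the case that `x` lies in `Y`. -/
theorem mem_comparePoss {W : Type v'} {D : W → Set W} {R : W → W → W → Prop} {X Y : Set W} {w : W}
    (h : (D w).Nonempty) :
    w ∈ comparePoss D R X Y ↔ ∀ x ∈ D w, x ∈ Y → ∃ y ∈ D w, y ∈ X ∧ R w y x := by
  refine forall₂_congr fun x _ => ⟨?_, ?_⟩
  · rintro ⟨y, hy, hxy⟩ hx
    exact ⟨y, hy, hxy hx⟩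
  · intro hxy
    by_cases hx : x ∈ Y
    · obtain ⟨y, hy, hyx⟩ := hxy hx
      exact ⟨y, hy, fun _ => hyx⟩
    · exact ⟨_, h.some_mem, fun h' => absurd h' hx⟩

variable {F V} {w : F.World}

theorem mem_truthSet_le {φ ψ : Formula P} :
    w ∈ F.truthSet V (le φ ψ) ↔ ∀ x ∈ F.dom w, x ∈ F.truthSet V ψ →
      ∃ y ∈ F.dom w, y ∈ F.truthSet V φ ∧ F.sim w y x := by
  rw [truthSet_le, mem_comparePoss ⟨w, F.self_mem_dom w⟩]

theorem mem_truthSet_dia {φ : Formula P} :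
    w ∈ F.truthSet V (dia φ) ↔ ∃ x ∈ F.dom w, x ∈ F.truthSet V φ := by
  rw [dia, lt, truthSet_neg, Set.mem_compl_iff, mem_truthSet_le]
  simp [truthSet_bot]

theorem self_mem_modeDom {ι : Type u'} [Fintype ι] (t : ι → Set F.World) (m : Mode) (w : F.World) :
    w ∈ F.modeDom t m w := by
  cases m
  · exact F.self_mem_dom w
  · exact ⟨F.self_mem_dom w, fun _ => Iff.rfl⟩
  · exact F.self_mem_dom w

variable (F V w)

open Classical in
/-- `A_Γ(x, w)` as a set of formulas. -/
noncomputable def agreeing (Γ : Finset (Formula P)) (x : F.World) : Finset (Formula P) :=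
  Γ.filter fun γ => (x ∈ F.truthSet V γ ↔ w ∈ F.truthSet V γ)

variable {F V w} {Γ : Finset (Formula P)}

theorem map_agree (x : F.World) :
    (F.agree (fun γ : Γ => F.truthSet V γ.1) x w).map (.subtype _) = F.agreeing V w Γ x := by
  ext γ
  simp [agree, agreeing, and_comm]

theorem card_agree (x : F.World) :
    (F.agree (fun γ : Γ => F.truthSet V γ.1) x w).card = (F.agreeing V w Γ x).card := by
  rw [← map_agree, Finset.card_map]

theorem agree_ssubset (x y : F.World) :
    F.agree (fun γ : Γ => F.truthSet V γ.1) x w ⊂ F.agree (fun γ : Γ => F.truthSet V γ.1) y w ↔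
      F.agreeing V w Γ x ⊂ F.agreeing V w Γ y := by
  rw [← map_agree, ← map_agree, Finset.map_ssubset_map]

theorem agree_eq (x y : F.World) :
    F.agree (fun γ : Γ => F.truthSet V γ.1) x w = F.agree (fun γ : Γ => F.truthSet V γ.1) y w ↔
      F.agreeing V w Γ x = F.agreeing V w Γ y := by
  rw [← map_agree, ← map_agree, Finset.map_inj]

theorem agreeing_subset (x : F.World) : F.agreeing V w Γ x ⊆ Γ := by
  classical
  exact Finset.filter_subset _ _

open Classical in
/-- If `S` describes `w`, then `λ^S_T` says of a world that it agrees with `w` on `T`. -/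
theorem mem_truthSet_lits {T : Finset (Formula P)} (hT : T ⊆ Γ) {x : F.World} :
    x ∈ F.truthSet V (lits (Γ.filter fun γ => w ∈ F.truthSet V γ) T) ↔
      T ⊆ F.agreeing V w Γ x := by
  rw [(F.isBoolean_truthSet V x).lits]
  refine forall₂_congr fun γ hγ => ?_
  simp only [agreeing, Finset.mem_filter, hT hγ, true_and]
  exact Iff.comm

theorem mem_cell {x : F.World} :
    x ∈ F.cell (fun γ : Γ => F.truthSet V γ.1) w ↔ x ∈ F.dom w ∧ Γ ⊆ F.agreeing V w Γ x := by
  refine and_congr_right fun _ => ?_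
  constructor
  · intro h γ hγ
    simp only [agreeing, Finset.mem_filter]
    exact ⟨hγ, (h ⟨γ, hγ⟩).symm⟩
  · rintro h ⟨γ, hγ⟩
    have := h hγ
    simp only [agreeing, Finset.mem_filter] at this
    exact this.2.symm

theorem mem_truthSet_reductCP {φ ψ : Formula P} :
    w ∈ F.truthSet V (reductCP Γ φ ψ) ↔
      ∀ x ∈ F.dom w, x ∈ F.truthSet V ψ → Γ ⊆ F.agreeing V w Γ x →
        ∃ y ∈ F.dom w, (y ∈ F.truthSet V φ ∧ Γ ⊆ F.agreeing V w Γ y) ∧ F.sim w y x := by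
  classical
  have hb := fun x => F.isBoolean_truthSet V x
  rw [reductCP, (hb w).bigAnd]
  simp only [(hb w).imp]
  rw [(hb w).forall_lits Γ fun S => w ∈ F.truthSet V (le (and φ (lits S Γ)) (and ψ (lits S Γ)))]
  simp only [mem_truthSet_le, (hb _).and, mem_truthSet_lits subset_rfl, and_imp]

theorem mem_truthSet_reductMS {φ ψ : Formula P} :
    w ∈ F.truthSet V (reductMS Γ φ ψ) ↔
      ∀ T ⊆ Γ, (∀ T' ⊆ Γ, T ⊂ T' →
          ¬ ∃ y ∈ F.dom w, y ∈ F.truthSet V φ ∧ T' ⊆ F.agreeing V w Γ y) →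
        ∀ x ∈ F.dom w, x ∈ F.truthSet V ψ → T ⊆ F.agreeing V w Γ x →
          ∃ y ∈ F.dom w, (y ∈ F.truthSet V φ ∧ T ⊆ F.agreeing V w Γ y) ∧ F.sim w y x := by
  classical
  have hb := fun x => F.isBoolean_truthSet V x
  rw [reductMS, (hb w).bigAnd]
  simp only [(hb w).imp]
  rw [(hb w).forall_lits Γ fun S => w ∈ F.truthSet V (bigAnd Γ.powerset fun T =>
    imp (bigAnd (Γ.powerset.filter fun T' => T ⊂ T') fun T' => neg (dia (and φ (lits S T'))))
      (le (and φ (lits S T)) (and ψ (lits S T))))]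
  rw [(hb w).bigAnd]
  simp only [Finset.mem_powerset, (hb w).imp, (hb w).bigAnd, (hb w).neg, mem_truthSet_dia,
    (hb _).and, Finset.mem_filter, and_imp, mem_truthSet_le]
  refine forall₂_congr fun T hT => imp_congr ?_ ?_
  · refine forall₃_congr fun T' hT' _ => ?_
    simp only [mem_truthSet_lits hT']
  · simp only [mem_truthSet_lits hT]

theorem mem_truthSet_reductNC {φ ψ : Formula P} :
    w ∈ F.truthSet V (reductNC Γ φ ψ) ↔
      ∀ T ⊆ Γ, (∀ T' ⊆ Γ, T.card < T'.card →
          ¬ ∃ y ∈ F.dom w, y ∈ F.truthSet V φ ∧ T' ⊆ F.agreeing V w Γ y) →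
        ∀ x ∈ F.dom w, x ∈ F.truthSet V ψ → T ⊆ F.agreeing V w Γ x →
          ∃ y ∈ F.dom w, (y ∈ F.truthSet V φ ∧
            ∃ T' ⊆ Γ, T'.card = T.card ∧ T' ⊆ F.agreeing V w Γ y) ∧ F.sim w y x := by
  classical
  have hb := fun x => F.isBoolean_truthSet V x
  rw [reductNC, (hb w).bigAnd]
  simp only [(hb w).imp]
  rw [(hb w).forall_lits Γ fun S => w ∈ F.truthSet V (bigAnd Γ.powerset fun T =>
    imp (bigAnd (Γ.powerset.filter fun T' => T.card < T'.card)
        fun T' => neg (dia (and φ (lits S T'))))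
      (le (and φ (bigOr (Γ.powerset.filter fun T' => T'.card = T.card) fun T' => lits S T'))
        (and ψ (lits S T))))]
  rw [(hb w).bigAnd]
  simp only [Finset.mem_powerset, (hb w).imp, (hb w).bigAnd, (hb w).neg, mem_truthSet_dia,
    (hb _).and, Finset.mem_filter, and_imp, mem_truthSet_le, (hb _).bigOr]
  refine forall₂_congr fun T hT => imp_congr ?_ ?_
  · refine forall₃_congr fun T' hT' _ => ?_
    simp only [mem_truthSet_lits hT']
  · refine forall₂_congr fun x _ => imp_congr_right fun _ =>
      imp_congr (mem_truthSet_lits hT) ?_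
    refine exists_congr fun y => and_congr_right fun _ => and_congr_left fun _ =>
      and_congr_right fun _ => exists_congr fun T' => ?_
    rw [and_assoc]
    exact and_congr_right fun hT' => and_congr_right fun _ => mem_truthSet_lits hT'

/-- The reduction equivalences are valid on every conditional frame. -/
theorem truthSet_cmp_eq_truthSet_reduct (F : ConditionalFrame.{v}) (V : P → Set F.World) (m : Mode)
    (Γ : Finset (Formula P)) (φ ψ : Formula P) :
    F.truthSet V (cmp m Γ φ ψ) = F.truthSet V (reduct m Γ φ ψ) := by
  ext w
  rw [truthSet_cmp, mem_comparePoss ⟨w, self_mem_modeDom _ m w⟩]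
  cases m
  · simp only [reduct, mem_truthSet_reductNC, modeDom, modeSim, card_agree]
    constructor
    · intro h T _ hmax x hx hxψ hTx
      obtain ⟨y, hy, hyφ, hyx⟩ := h x hx hxψ
      -- By maximality `y` agrees with `w` on at most `|T|` formulas, so `y` does not win by number.
      have hle : (F.agreeing V w Γ y).card ≤ T.card :=
        not_lt.1 fun hlt => hmax _ (agreeing_subset y) hlt ⟨y, hy, hyφ, subset_rfl⟩
      have hTx' := Finset.card_le_card hTx
      rcases hyx with hlt | ⟨he, hs⟩
      · omega
      · exact ⟨y, hy, ⟨hyφ, _, agreeing_subset y, by omega, subset_rfl⟩, hs⟩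
    · intro h x hx hxψ
      by_cases hex : ∃ y ∈ F.dom w, y ∈ F.truthSet V φ ∧
          (F.agreeing V w Γ x).card < (F.agreeing V w Γ y).card
      · obtain ⟨y, hy, hyφ, hlt⟩ := hex
        exact ⟨y, hy, hyφ, Or.inl hlt⟩
      · obtain ⟨y, hy, ⟨hyφ, T', -, hc, hT'y⟩, hs⟩ := h _ (agreeing_subset x)
          (fun T' _ hlt ⟨y, hy, hyφ, hT'y⟩ =>
            hex ⟨y, hy, hyφ, hlt.trans_le (Finset.card_le_card hT'y)⟩) x hx hxψ subset_rfl
        have := Finset.card_le_card hT'y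
        rcases (hc ▸ this : (F.agreeing V w Γ x).card ≤ _).lt_or_eq with hlt | he
        · exact ⟨y, hy, hyφ, Or.inl hlt⟩
        · exact ⟨y, hy, hyφ, Or.inr ⟨he.symm, hs⟩⟩
  · simp only [reduct, mem_truthSet_reductCP, modeDom, modeSim, mem_cell]
    constructor
    · intro h x hx hxψ hxΓ
      obtain ⟨y, ⟨hy, hyΓ⟩, hyφ, hs, -⟩ := h x ⟨hx, hxΓ⟩ hxψ
      exact ⟨y, hy, ⟨hyφ, hyΓ⟩, hs⟩
    · rintro h x ⟨hx, hxΓ⟩ hxψ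
      obtain ⟨y, hy, ⟨hyφ, hyΓ⟩, hs⟩ := h x hx hxψ hxΓ
      exact ⟨y, ⟨hy, hyΓ⟩, hyφ, hs, ⟨hy, hyΓ⟩, hx, hxΓ⟩
  · simp only [reduct, mem_truthSet_reductMS, modeDom, modeSim, agree_ssubset, agree_eq]
    constructor
    · intro h T _ hmax x hx hxψ hTx
      obtain ⟨y, hy, hyφ, hyx⟩ := h x hx hxψ
      have hnot : ¬ T ⊂ F.agreeing V w Γ y := fun hlt =>
        hmax _ (agreeing_subset y) hlt ⟨y, hy, hyφ, subset_rfl⟩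
      rcases hyx with hlt | ⟨he, hs⟩
      · exact absurd (hTx.trans_ssubset hlt) hnot
      · exact ⟨y, hy, ⟨hyφ, he ▸ hTx⟩, hs⟩
    · intro h x hx hxψ
      by_cases hex : ∃ y ∈ F.dom w, y ∈ F.truthSet V φ ∧
          F.agreeing V w Γ x ⊂ F.agreeing V w Γ y
      · obtain ⟨y, hy, hyφ, hlt⟩ := hex
        exact ⟨y, hy, hyφ, Or.inl hlt⟩
      · obtain ⟨y, hy, ⟨hyφ, hxy⟩, hs⟩ := h _ (agreeing_subset x)
          (fun T' _ hlt ⟨y, hy, hyφ, hT'y⟩ =>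
            hex ⟨y, hy, hyφ, hlt.trans_subset hT'y⟩) x hx hxψ subset_rfl
        rcases hxy.ssubset_or_eq with hlt | he
        · exact ⟨y, hy, hyφ, Or.inl hlt⟩
        · exact ⟨y, hy, hyφ, Or.inr ⟨he, hs⟩⟩

/-- Finitely many worlds in the domain of `w`, at least one, have a `⪯_w`-least one among them. -/
theorem exists_least (F : ConditionalFrame.{v}) (w : F.World) {ι : Type u'} (x : ι → F.World)
    {l : List ι} (hl : l ≠ []) (h : ∀ i ∈ l, x i ∈ F.dom w) :
    ∃ i ∈ l, ∀ j ∈ l, F.sim w (x i) (x j) := by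
  induction l with
  | nil => exact absurd rfl hl
  | cons a l ih =>
    have ha := h a List.mem_cons_self
    rcases eq_or_ne l [] with rfl | hl'
    · exact ⟨a, List.mem_cons_self, by simpa using F.sim_refl w _ ha⟩
    · obtain ⟨i, hi, hmin⟩ := ih hl' fun i hi => h i (List.mem_cons_of_mem _ hi)
      rcases F.sim_total w _ ha _ (h i (List.mem_cons_of_mem _ hi)) with hai | hia
      · refine ⟨a, List.mem_cons_self, ?_⟩
        intro j hj
        rcases List.mem_cons.1 hj with rfl | hj
        · exact F.sim_refl w _ ha
        · exact F.sim_trans w _ _ _ hai (hmin j hj)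
      · refine ⟨i, List.mem_cons_of_mem _ hi, ?_⟩
        intro j hj
        rcases List.mem_cons.1 hj with rfl | hj
        · exact hia
        · exact hmin j hj

theorem eq_self_of_sim (F : ConditionalFrame.{v}) {w x : F.World} (h : F.sim w x w) : x = w := by
  by_contra hne
  exact (F.centered w x (F.mem_dom_of_sim w x w h).1 hne).2 h

theorem sim_self_left (F : ConditionalFrame.{v}) {w x : F.World} (hx : x ∈ F.dom w) :
    F.sim w w x := by
  by_cases h : x = w
  · exact h ▸ F.sim_refl w x hx
  · exact (F.centered w x hx h).1

end ConditionalFrame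

open ConditionalFrame in
theorem Provable.mem_truthSet {φ : Formula P} (h : Provable φ) (F : ConditionalFrame.{v})
    (V : P → Set F.World) (w : F.World) : w ∈ F.truthSet V φ := by
  have hb := fun x => F.isBoolean_truthSet V x
  induction h generalizing w with
  | taut h => exact h (fun φ => w ∈ F.truthSet V φ) (hb w).bot (hb w).neg (hb w).or
  | mp _ _ ih₁ ih₂ => exact ((hb w).imp _ _).1 (ih₁ w) (ih₂ w)
  | @cpr φ l hl _ ih =>
    rw [(hb w).disj]
    by_contra hcon
    have hfail : ∀ ψ ∈ l, ∃ x ∈ F.dom w, x ∈ F.truthSet V φ ∧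
        ∀ y ∈ F.dom w, y ∈ F.truthSet V ψ → ¬ F.sim w y x := by
      intro ψ hψ
      have : w ∉ F.truthSet V (le ψ φ) := fun h => hcon ⟨_, List.mem_map.2 ⟨ψ, hψ, rfl⟩, h⟩
      rw [mem_truthSet_le] at this
      push Not at this
      exact this
    have := F.nonempty
    choose! x hx using hfail
    -- The least of the counterexamples `x ψ` satisfies some `χ` in the list, but lies below `x χ`.
    obtain ⟨ψ, hψ, hmin⟩ := F.exists_least w x hl fun ψ hψ => (hx ψ hψ).1
    obtain ⟨χ, hχ, hxχ⟩ := ((hb _).disj l).1 (((hb _).imp _ _).1 (ih (x ψ)) (hx ψ hψ).2.1)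
    exact (hx χ hχ).2.2 _ (hx ψ hψ).1 hxχ (hmin χ hχ)
  | trans φ ψ χ =>
    rw [(hb w).imp, (hb w).and, mem_truthSet_le, mem_truthSet_le, mem_truthSet_le]
    rintro ⟨h₁, h₂⟩ x hx hxχ
    obtain ⟨y, hy, hyψ, hyx⟩ := h₂ x hx hxχ
    obtain ⟨z, hz, hzφ, hzy⟩ := h₁ y hy hyψ
    exact ⟨z, hz, hzφ, F.sim_trans w _ _ _ hzy hyx⟩
  | connex φ ψ =>
    rw [(hb w).or, or_iff_not_imp_left, mem_truthSet_le, mem_truthSet_le]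
    intro h x hx hxφ
    push Not at h
    obtain ⟨y, hy, hyψ, hmin⟩ := h
    exact ⟨y, hy, hyψ, (F.sim_total w y hy x hx).resolve_right (hmin x hx hxφ)⟩
  | weakCentering φ =>
    rw [(hb w).imp, mem_truthSet_le]
    exact fun hw x hx _ => ⟨w, F.self_mem_dom w, hw, F.sim_self_left hx⟩
  | centering φ =>
    rw [(hb w).imp, mem_truthSet_le]
    intro h
    obtain ⟨y, -, hyφ, hyw⟩ := h w (F.self_mem_dom w) (hb w).top
    exact F.eq_self_of_sim hyw ▸ hyφ
  | reduction m Γ φ ψ =>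
    rw [(hb w).iff, truthSet_cmp_eq_truthSet_reduct]

/-! ### Theories -/

/-- Complete consistent theories: Boolean valuations under which all theorems are true. -/
structure IsTheory (t : Formula P → Prop) : Prop extends IsBoolean t where
  provable : ∀ {φ}, Provable φ → t φ

theorem Provable.of_forall_isBoolean {φ ψ : Formula P} (h : Provable φ)
    (hψ : ∀ t, IsBoolean t → t φ → t ψ) : Provable ψ := by
  refine .mp (.taut fun t h₁ h₂ h₃ => ?_) h
  have ht : IsBoolean t := ⟨h₁, h₂, h₃⟩
  exact (ht.imp _ _).2 (hψ t ht)

theorem Provable.and {φ ψ : Formula P} (hφ : Provable φ) (hψ : Provable ψ) :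
    Provable (and φ ψ) := by
  refine .mp (hφ.of_forall_isBoolean fun t ht h => ?_) hψ
  rw [ht.imp, ht.and]
  exact fun h' => ⟨h, h'⟩

/-- Lindenbaum's lemma. For every theorem `χ` some Boolean valuation makes `χ` true and `φ` false;
an ultrafilter limit of these valuations is a theory that omits `φ`. -/
theorem provable_iff_forall_isTheory {φ : Formula P} :
    Provable φ ↔ ∀ t, IsTheory t → t φ := by
  refine ⟨fun h t ht => ht.provable h, fun h => ?_⟩
  by_contra hφ
  let K : {χ : Formula P // Provable χ} → Set {t : Formula P → Prop // IsBoolean t} :=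
    fun χ => {t | t.1 χ.1 ∧ ¬ t.1 φ}
  have hK : ∀ χ, (K χ).Nonempty := by
    rintro ⟨χ, hχ⟩
    by_contra hne
    refine hφ (hχ.of_forall_isBoolean fun t ht htχ => ?_)
    by_contra htφ
    exact hne ⟨⟨t, ht⟩, htχ, htφ⟩
  have : Nonempty {χ : Formula P // Provable χ} :=
    ⟨⟨Formula.top, .taut fun t h₁ h₂ _ => (h₂ _).2 h₁⟩⟩
  have hdir : Directed (· ≥ ·) fun χ => Filter.principal (K χ) := by
    rintro ⟨χ, hχ⟩ ⟨θ, hθ⟩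
    refine ⟨⟨_, hχ.and hθ⟩, Filter.principal_mono.2 ?_, Filter.principal_mono.2 ?_⟩
    · exact fun t ht => ⟨((t.2.and _ _).1 ht.1).1, ht.2⟩
    · exact fun t ht => ⟨((t.2.and _ _).1 ht.1).2, ht.2⟩
  have : (⨅ χ, Filter.principal (K χ)).NeBot :=
    Filter.iInf_neBot_of_directed' hdir fun χ => Filter.principal_neBot_iff.2 (hK χ)
  let U := Ultrafilter.of (⨅ χ, Filter.principal (K χ))
  have hU : ∀ χ, ∀ᶠ t in (U : Filter _), t ∈ K χ := fun χ =>
    Ultrafilter.of_le _ (Filter.mem_iInf_of_mem χ (Filter.mem_principal_self _))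
  have hlim : IsTheory fun χ => ∀ᶠ t in (U : Filter {t : Formula P → Prop // IsBoolean t}), t.1 χ :=
    { bot := by
        simp only [show ∀ t : {t : Formula P → Prop // IsBoolean t}, ¬ t.1 Formula.bot from
          fun t => t.2.bot]
        exact Filter.eventually_false_iff_eq_bot.not.2 U.neBot.ne
      neg := fun χ => by
        simp only [fun t : {t : Formula P → Prop // IsBoolean t} => t.2.neg χ]
        exact Ultrafilter.eventually_not
      or := fun χ θ => by
        simp only [fun t : {t : Formula P → Prop // IsBoolean t} => t.2.or χ θ]
        exact Ultrafilter.eventually_or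
      provable := fun hχ => (hU ⟨_, hχ⟩).mono fun t ht => ht.1 }
  have h₁ := h _ hlim
  obtain ⟨t, ht, ht'⟩ := (h₁.and (hU (Classical.arbitrary _))).exists
  exact ht'.2 ht

namespace IsTheory

variable {t : Formula P → Prop} {φ ψ χ : Formula P}

theorem le_trans (ht : IsTheory t) (h₁ : t (le φ ψ)) (h₂ : t (le ψ χ)) : t (le φ χ) :=
  (ht.imp _ _).1 (ht.provable (.trans φ ψ χ)) ((ht.and _ _).2 ⟨h₁, h₂⟩)

theorem le_total (ht : IsTheory t) (φ ψ : Formula P) : t (le φ ψ) ∨ t (le ψ φ) :=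
  (ht.or _ _).1 (ht.provable (.connex φ ψ))

theorem le_top_iff (ht : IsTheory t) : t (le φ top) ↔ t φ :=
  ⟨(ht.imp _ _).1 (ht.provable (.centering φ)), (ht.imp _ _).1 (ht.provable (.weakCentering φ))⟩

/-- The rule for comparative possibility, with `⊥` added to the list of disjuncts so that the list
may be empty. -/
theorem exists_le (ht : IsTheory t) (l : List (Formula P))
    (h : ∀ s, IsTheory s → s φ → ∃ χ ∈ l, s χ) : t (le bot φ) ∨ ∃ χ ∈ l, t (le χ φ) := by
  have hp : Provable (Formula.imp φ (Formula.disj (Formula.bot :: l))) := by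
    refine provable_iff_forall_isTheory.2 fun s hs => (hs.imp _ _).2 fun hφ => (hs.disj _).2 ?_
    obtain ⟨χ, hχ, hsχ⟩ := h s hs hφ
    exact ⟨χ, List.mem_cons_of_mem _ hχ, hsχ⟩
  obtain ⟨θ, hθ, htθ⟩ := (ht.disj _).1 (ht.provable (.cpr (List.cons_ne_nil _ _) hp))
  obtain ⟨χ, hχ, rfl⟩ := List.mem_map.1 hθ
  rcases List.mem_cons.1 hχ with rfl | hχ
  · exact Or.inl htθ
  · exact Or.inr ⟨χ, hχ, htθ⟩

theorem le_of_imp (ht : IsTheory t) (h : ∀ s, IsTheory s → s ψ → s φ) : t (le φ ψ) := by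
  have hp : Provable (Formula.imp ψ (Formula.disj [φ])) :=
    provable_iff_forall_isTheory.2 fun s hs => (hs.imp _ _).2 fun hψ =>
      (hs.disj _).2 ⟨φ, List.mem_singleton_self _, h s hs hψ⟩
  simpa using (ht.disj _).1 (ht.provable (.cpr (List.cons_ne_nil _ _) hp))

theorem bot_le_trans (ht : IsTheory t) (h : t (le bot φ)) (χ : Formula P) : t (le χ φ) :=
  ht.le_trans (ht.le_of_imp fun _ hs h => absurd h hs.bot) h

end IsTheory

/-! ### The finite canonical model -/

/-- A system of representatives for the theories modulo agreement on the finite set `D`, indexed by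
a finite type `W`. -/
structure Canonical (D : Finset (Formula P)) (W : Type v) where
  /-- The theory that represents a world. -/
  τ : W → Formula P → Prop
  isTheory : ∀ w, IsTheory (τ w)
  exists_agree : ∀ t, IsTheory t → ∃ w, ∀ δ ∈ D, τ w δ ↔ t δ
  eq_of_agree : ∀ w w', (∀ δ ∈ D, τ w δ ↔ τ w' δ) → w = w'
  finite : Finite W

/-- The representatives can be indexed by a type in any universe, as there are finitely many. -/
theorem exists_canonical (D : Finset (Formula P)) :
    ∃ W : Type v, Nonempty (Canonical D W) := by
  let r : Setoid {t : Formula P → Prop // IsTheory t} :=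
    { r := fun s t => ∀ δ ∈ D, s.1 δ ↔ t.1 δ
      iseqv := ⟨fun _ _ _ => Iff.rfl, fun h δ hδ => (h δ hδ).symm,
        fun h₁ h₂ δ hδ => (h₁ δ hδ).trans (h₂ δ hδ)⟩ }
  have hfin : Finite (Quotient r) := by
    refine Finite.of_injective (β := D → Prop) (fun q δ => q.out.1 δ.1) fun q q' h => ?_
    rw [← q.out_eq, ← q'.out_eq]
    exact Quotient.sound fun δ hδ => iff_of_eq (congrFun h ⟨δ, hδ⟩)
  obtain ⟨n, ⟨e⟩⟩ := Finite.exists_equiv_fin (Quotient r)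
  let e' : ULift.{v} (Fin n) ≃ Quotient r := Equiv.ulift.trans e.symm
  refine ⟨ULift.{v} (Fin n), ⟨⟨fun w => (e' w).out.1, fun w => (e' w).out.2, ?_, ?_, inferInstance⟩⟩⟩
  · intro t ht
    refine ⟨e'.symm (Quotient.mk r ⟨t, ht⟩), ?_⟩
    rw [Equiv.apply_symm_apply]
    exact Quotient.mk_out (s := r) ⟨t, ht⟩
  · intro w w' h
    apply e'.injective
    rw [← (e' w).out_eq, ← (e' w').out_eq]
    exact Quotient.sound h

namespace Canonical

variable {D : Finset (Formula P)} {W : Type v} (M : Canonical D W)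

open Classical in
/-- The conjunction of literals over `D` that describes the world `w`. -/
noncomputable def α (w : W) : Formula P := lits (D.filter (M.τ w)) D

theorem mem_α {t : Formula P → Prop} (ht : IsTheory t) {w : W} :
    t (M.α w) ↔ ∀ δ ∈ D, M.τ w δ ↔ t δ := by
  rw [α, ht.lits]
  exact forall₂_congr fun δ hδ => by simp [hδ]

theorem self_mem_α (w : W) : M.τ w (M.α w) := (M.mem_α (M.isTheory w)).2 fun _ _ => Iff.rfl

theorem eq_of_mem_α {w u : W} (h : M.τ w (M.α u)) : u = w :=
  M.eq_of_agree _ _ ((M.mem_α (M.isTheory w)).1 h)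

theorem self_le (w : W) (φ : Formula P) : M.τ w (le (M.α w) φ) :=
  (M.isTheory w).le_trans ((M.isTheory w).le_top_iff.2 (M.self_mem_α w))
    ((M.isTheory w).le_of_imp fun _ hs _ => hs.top)

theorem eq_of_le_self {w u : W} (h : M.τ w (le (M.α u) (M.α w))) : u = w :=
  M.eq_of_mem_α ((M.isTheory w).le_top_iff.1 ((M.isTheory w).le_trans h
    ((M.isTheory w).le_top_iff.2 (M.self_mem_α w))))

theorem not_bot_le_self (w : W) : ¬ M.τ w (le bot (M.α w)) := fun h =>
  (M.isTheory w).bot ((M.isTheory w).le_top_iff.1 ((M.isTheory w).le_trans h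
    ((M.isTheory w).le_top_iff.2 (M.self_mem_α w))))

/-- The frame of the canonical model: `u` is entertainable from `w` iff `◇ α u` belongs to `τ w`,
and the order on these worlds is given by the formulas `α u ⪯ α v` in `τ w`. -/
def frame [Nonempty W] : ConditionalFrame.{v} where
  World := W
  nonempty := inferInstance
  dom w := {u | ¬ M.τ w (le bot (M.α u))}
  sim w u v := (¬ M.τ w (le bot (M.α u)) ∧ ¬ M.τ w (le bot (M.α v))) ∧ M.τ w (le (M.α u) (M.α v))
  mem_dom_of_sim _ _ _ h := h.1
  self_mem_dom := M.not_bot_le_self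
  sim_refl w _ hu := ⟨⟨hu, hu⟩, (M.isTheory w).le_of_imp fun _ _ h => h⟩
  sim_trans w _ _ _ h₁ h₂ := ⟨⟨h₁.1.1, h₂.1.2⟩, (M.isTheory w).le_trans h₁.2 h₂.2⟩
  sim_total w u hu v hv := ((M.isTheory w).le_total (M.α u) (M.α v)).imp
    (fun h => ⟨⟨hu, hv⟩, h⟩) fun h => ⟨⟨hv, hu⟩, h⟩
  centered w _ hu hne :=
    ⟨⟨⟨M.not_bot_le_self w, hu⟩, M.self_le w _⟩, fun h => hne (M.eq_of_le_self h.2)⟩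

/-- The valuation of the canonical model. -/
def val [Nonempty W] (p : P) : Set M.frame.World := {w | M.τ w (var p)}

theorem limitAssumption_frame [Nonempty W] : M.frame.LimitAssumption := by
  intro w S hS
  have : Finite M.frame.World := M.finite
  -- A world of `S ∩ dom w` with the fewest predecessors is minimal.
  obtain ⟨x, hx, hmin⟩ := Set.exists_min_image (S ∩ M.frame.dom w)
    (fun x => {y | M.frame.sim w y x}.ncard) (Set.toFinite _) hS
  refine ⟨x, hx, fun y hy hyx => (hmin y hy).not_gt (Set.ncard_lt_ncard ?_ (Set.toFinite _))⟩
  refine ⟨fun z hz => M.frame.sim_trans w _ _ _ hz hyx.1, fun hsub => hyx.2 ?_⟩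
  exact hsub (M.frame.sim_refl w x hx.2)

/-- The worlds that satisfy `φ` cover `φ`: in the theory of `w` one of them is at least as possible
as `φ`, unless `φ` is impossible. -/
theorem exists_α_le {φ : Formula P} (hφ : φ ∈ D) (w : W) :
    M.τ w (le bot φ) ∨ ∃ u, M.τ u φ ∧ M.τ w (le (M.α u) φ) := by
  classical
  have := M.finite
  have := Fintype.ofFinite W
  refine ((M.isTheory w).exists_le
    ((Finset.univ.filter fun u => M.τ u φ).toList.map M.α) fun s hs hsφ => ?_).imp_right ?_
  · obtain ⟨u, hu⟩ := M.exists_agree s hs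
    refine ⟨M.α u, List.mem_map.2 ⟨u, ?_, rfl⟩, (M.mem_α hs).2 hu⟩
    simpa using (hu φ hφ).2 hsφ
  · rintro ⟨χ, hχ, hle⟩
    obtain ⟨u, hu, rfl⟩ := List.mem_map.1 hχ
    exact ⟨u, by simpa using hu, hle⟩

theorem le_α {φ : Formula P} (hφ : φ ∈ D) {u : W} (hu : M.τ u φ) (w : W) :
    M.τ w (le φ (M.α u)) :=
  (M.isTheory w).le_of_imp fun _ hs h => ((M.mem_α hs).1 h φ hφ).1 hu

/-- The canonical model interprets `⪯` as the theories do. -/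
theorem le_mem_iff [Nonempty W] {φ ψ : Formula P} (hφ : φ ∈ D) (hψ : ψ ∈ D) (w : W) :
    M.τ w (le φ ψ) ↔ ∀ x ∈ M.frame.dom w, M.τ x ψ →
      ∃ y ∈ M.frame.dom w, M.τ y φ ∧ M.frame.sim w y x := by
  have ht := M.isTheory w
  constructor
  · intro h x hx hxψ
    have hφx : M.τ w (le φ (M.α x)) := ht.le_trans h (M.le_α hψ hxψ w)
    rcases M.exists_α_le hφ w with hb | ⟨y, hyφ, hy⟩
    · exact absurd (ht.le_trans hb hφx) hx
    · have hyx := ht.le_trans hy hφx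
      have hy' : y ∈ M.frame.dom w := fun hb => hx (ht.le_trans hb hyx)
      exact ⟨y, hy', hyφ, ⟨hy', hx⟩, hyx⟩
  · intro h
    rcases M.exists_α_le hψ w with hb | ⟨x, hxψ, hx⟩
    · exact ht.bot_le_trans hb φ
    · by_cases hxd : M.τ w (le bot (M.α x))
      · exact ht.bot_le_trans (ht.le_trans hxd hx) φ
      · obtain ⟨y, -, hyφ, hyx⟩ := h x hxd hxψ
        exact ht.le_trans (M.le_α hφ hyφ w) (ht.le_trans hyx.2 hx)

end Canonical

/-! ### The truth lemma and completeness -/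

/-- `φ` satisfies the truth lemma in the canonical models over all large enough finite sets. -/
def TruthLemma (φ : Formula P) : Prop :=
  ∃ D₀ : Finset (Formula P), ∀ D : Finset (Formula P), D₀ ⊆ D →
    ∀ (W : Type v) [Nonempty W] (M : Canonical D W) (w : M.frame.World),
      w ∈ M.frame.truthSet M.val φ ↔ M.τ w φ

namespace TruthLemma

variable {φ ψ : Formula P}

theorem bot : TruthLemma.{u, v} (bot : Formula P) := by
  refine ⟨∅, fun D _ W _ M w => iff_of_false ?_ (M.isTheory w).bot⟩
  exact (M.frame.isBoolean_truthSet M.val w).bot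

theorem neg (h : TruthLemma.{u, v} φ) : TruthLemma.{u, v} (neg φ) := by
  obtain ⟨D₀, h⟩ := h
  refine ⟨D₀, fun D hD W _ M w => ?_⟩
  rw [(M.isTheory w).neg, (M.frame.isBoolean_truthSet M.val w).neg, h D hD W M w]

theorem or (hφ : TruthLemma.{u, v} φ) (hψ : TruthLemma.{u, v} ψ) :
    TruthLemma.{u, v} (or φ ψ) := by
  classical
  obtain ⟨D₁, hφ⟩ := hφ
  obtain ⟨D₂, hψ⟩ := hψ
  refine ⟨D₁ ∪ D₂, fun D hD W _ M w => ?_⟩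
  rw [(M.isTheory w).or, (M.frame.isBoolean_truthSet M.val w).or,
    hφ D (Finset.union_subset_left hD) W M w, hψ D (Finset.union_subset_right hD) W M w]

theorem le (hφ : TruthLemma.{u, v} φ) (hψ : TruthLemma.{u, v} ψ) :
    TruthLemma.{u, v} (le φ ψ) := by
  classical
  obtain ⟨D₁, hφ⟩ := hφ
  obtain ⟨D₂, hψ⟩ := hψ
  refine ⟨{φ, ψ} ∪ (D₁ ∪ D₂), fun D hD W _ M w => ?_⟩
  have hD' := Finset.union_subset_right hD
  have hp := Finset.union_subset_left hD
  rw [ConditionalFrame.mem_truthSet_le,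
    M.le_mem_iff (hp (by simp) : φ ∈ D) (hp (by simp) : ψ ∈ D) w]
  simp only [hφ D (Finset.union_subset_left hD') W M, hψ D (Finset.union_subset_right hD') W M]

theorem and (hφ : TruthLemma.{u, v} φ) (hψ : TruthLemma.{u, v} ψ) :
    TruthLemma.{u, v} (and φ ψ) := (hφ.neg.or hψ.neg).neg

theorem imp (hφ : TruthLemma.{u, v} φ) (hψ : TruthLemma.{u, v} ψ) :
    TruthLemma.{u, v} (imp φ ψ) := hφ.neg.or hψ

theorem dia (hφ : TruthLemma.{u, v} φ) : TruthLemma.{u, v} (dia φ) := (TruthLemma.bot.le hφ).neg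

theorem bigOr {ι : Type u'} {s : Finset ι} {f : ι → Formula P}
    (h : ∀ i ∈ s, TruthLemma.{u, v} (f i)) : TruthLemma.{u, v} (bigOr s f) := by
  have : ∀ l : List (Formula P), (∀ χ ∈ l, TruthLemma.{u, v} χ) → TruthLemma.{u, v} (disj l) := by
    intro l hl
    induction l with
    | nil => exact TruthLemma.bot
    | cons χ l ih => exact (hl χ (by simp)).or (ih fun θ hθ => hl θ (by simp [hθ]))
  refine this _ fun χ hχ => ?_
  obtain ⟨i, hi, rfl⟩ := List.mem_map.1 hχ
  exact h i (Finset.mem_toList.1 hi)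

theorem bigAnd {ι : Type u'} {s : Finset ι} {f : ι → Formula P}
    (h : ∀ i ∈ s, TruthLemma.{u, v} (f i)) : TruthLemma.{u, v} (bigAnd s f) := by
  have : ∀ l : List (Formula P), (∀ χ ∈ l, TruthLemma.{u, v} χ) → TruthLemma.{u, v} (conj l) := by
    intro l hl
    induction l with
    | nil => exact TruthLemma.bot.neg
    | cons χ l ih => exact (hl χ (by simp)).and (ih fun θ hθ => hl θ (by simp [hθ]))
  refine this _ fun χ hχ => ?_
  obtain ⟨i, hi, rfl⟩ := List.mem_map.1 hχ
  exact h i (Finset.mem_toList.1 hi)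

theorem lits {Γ : Finset (Formula P)} (h : ∀ γ ∈ Γ, TruthLemma.{u, v} γ)
    (S : Finset (Formula P)) {T : Finset (Formula P)} (hT : T ⊆ Γ) :
    TruthLemma.{u, v} (lits S T) := by
  refine bigAnd fun γ hγ => ?_
  split_ifs
  · exact h γ (hT hγ)
  · exact (h γ (hT hγ)).neg

theorem reduct (m : Mode) {Γ : Finset (Formula P)} (hΓ : ∀ γ ∈ Γ, TruthLemma.{u, v} γ)
    (hφ : TruthLemma.{u, v} φ) (hψ : TruthLemma.{u, v} ψ) :
    TruthLemma.{u, v} (reduct m Γ φ ψ) := by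
  have hl := fun S T (hT : T ∈ Γ.powerset) => lits hΓ S (Finset.mem_powerset.1 hT)
  have hl' := fun S T p {_ : DecidablePred p} (hT : T ∈ Γ.powerset.filter p) =>
    hl S T (Finset.mem_filter.1 hT).1
  cases m
  · refine bigAnd fun S _ => (lits hΓ S subset_rfl).imp (bigAnd fun T hT => imp ?_ ?_)
    · exact bigAnd fun T' hT' => (hφ.and (hl' S T' _ hT')).dia.neg
    · exact (hφ.and (bigOr fun T' hT' => hl' S T' _ hT')).le (hψ.and (hl S T hT))
  · exact bigAnd fun S _ => (lits hΓ S subset_rfl).imp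
      ((hφ.and (lits hΓ S subset_rfl)).le (hψ.and (lits hΓ S subset_rfl)))
  · refine bigAnd fun S _ => (lits hΓ S subset_rfl).imp (bigAnd fun T hT => imp ?_ ?_)
    · exact bigAnd fun T' hT' => (hφ.and (hl' S T' _ hT')).dia.neg
    · exact (hφ.and (hl S T hT)).le (hψ.and (hl S T hT))

end TruthLemma

theorem truthLemma (φ : Formula P) : TruthLemma.{u, v} φ := by
  induction φ using Formula.induction with
  | var p =>
    refine ⟨∅, fun D _ W _ M w => ?_⟩
    rw [ConditionalFrame.truthSet_var]
    exact Iff.rfl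
  | bot => exact .bot
  | neg φ h => exact h.neg
  | or φ ψ hφ hψ => exact hφ.or hψ
  | le φ ψ hφ hψ => exact hφ.le hψ
  | cmp m Γ φ ψ hΓ hφ hψ =>
    obtain ⟨D₀, h⟩ := TruthLemma.reduct m hΓ hφ hψ
    refine ⟨D₀, fun D hD W _ M w => ?_⟩
    rw [ConditionalFrame.truthSet_cmp_eq_truthSet_reduct, h D hD W M w]
    exact (((M.isTheory w).iff _ _).1 ((M.isTheory w).provable (.reduction m Γ φ ψ))).symm

theorem Provable.of_mem_logicOf {φ : Formula P}
    (h : φ ∈ logicOf.{u, v} P {F | F.LimitAssumption}) : Provable φ := by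
  classical
  refine provable_iff_forall_isTheory.2 fun t ht => ?_
  obtain ⟨D₀, hD₀⟩ := truthLemma.{u, v} φ
  obtain ⟨W, ⟨M⟩⟩ := exists_canonical.{u, v} (insert φ D₀)
  obtain ⟨w, hw⟩ := M.exists_agree t ht
  have : Nonempty W := ⟨w⟩
  rw [← hw φ (Finset.mem_insert_self _ _), ← hD₀ _ (Finset.subset_insert _ _) W M w]
  exact h M.frame M.limitAssumption_frame M.val w

end CeterisParibus

theorem mainTheorem2 (P : Type u) :
    (∀ φ : CeterisParibus.Formula P, CeterisParibus.Provable φ ↔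
      φ ∈ CeterisParibus.logicOf.{u, v} P {F | F.LimitAssumption}) ∧
    (∀ φ : CeterisParibus.Formula P, CeterisParibus.Provable φ ↔
      φ ∈ CeterisParibus.logicOf.{u, v} P Set.univ) :=
  ⟨fun _ => ⟨fun h F _ => h.mem_truthSet F, .of_mem_logicOf⟩,
    fun _ => ⟨fun h F _ => h.mem_truthSet F, fun h => .of_mem_logicOf fun F _ => h F trivial⟩⟩
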